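/- Let $F$ be a finite field with $q$ elements, let $n,m$ be non-negative integers, and let $E=F^n$ with its standard inner product; $J^\perp$ denotes the orthogonal complement of a subspace $J\le E$. **Notation.** For $\ell\ge 0$ put $g_\ell(X,Y)=\prod_{i=0}^{\ell-1}(X-q^iY)$. For $a\in\mathbb Z$ and $b\ge0$ put $\left[{a\atop b}\right]_q=\prod_{i=0}^{b-1}\frac{q^{a-i}-1}{q^{b-i}-1}$. A *$(q,m)$-polymatroid* $P=(E,\rho)$ is a function $\rho$ from the subspaces of $E$ to $\mathbb Z_{\ge0}$ such that $\rho(A)\le m\dim A$, $\rho(A)\le\rho(B)$ whenever $A\le B$, and $\rho(A+B)+\rho(A\cap B)\le\rho(A)+\rho(B)$. Its dual $P^*=(E,\rho^*)$ is given by $\rho^*(J)=\rho(J^\perp)+m\dim J-\rho(E)$ and is again a $(q,m)$-polymatroid. For $r\ge0$, the $r$-th higher weight polynomial of $P$ is $$W_P^{(r)}(x,y)=\sum_{U\le E}\left[{\rho(E)-\rho(U)\atop r}\right]_q y^{\,n-\dim U}g_{\dim U}(x,y).$$ *$q$-products and $q$-transforms.* Let $a(x,y;\mu)=\sum_{i=0}^{d}a_i(\mu)x^{d-i}y^i$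 and $b(x,y;\mu)=\sum_{i=0}^{s}b_i(\mu)x^{s-i}y^i$ be homogeneous polynomials of degrees $d$ and $s$ whose coefficients are real-valued functions of $\mu\in\mathbb Z$ (coefficients outside the indicated ranges are zero). Their $q$-product is $$(a*_\mu b)(x,y;\mu)=\sum_{u=0}^{d+s}c_u(\mu)x^{d+s-u}y^u,\qquad c_u(\mu)=\sum_{i=0}^{u}q^{is}a_i(\mu)\,b_{u-i}(\mu-i),$$ and the $q$-powers are $a^{\langle0\rangle}=1$, $a^{\langle N\rangle}=a^{\langle N-1\rangle}*_\mu a$ for $N\ge1$. For $F(x,y)=\sum_{i=0}^n f_i x^{n-i}y^i$ and $\mu\in\mathbb Z$, the $q$-transform of $F$ with parameter $\mu$, evaluated at $(x+(q^\mu-1)y,\;x-y)$, is $$\overline F^{(\mu)}\bigl(x+(q^{\mu}-1)y,\;x-y\bigr)=\sum_{i=0}^n f_i\,(x-y)^{\langle i\rangle}*_\mu\bigl(x+(q^\mu-1)y\bigr)^{\langle n-i\rangle},$$ where $x+(q^\mu-1)y$ is treated as a form whose coefficients depend on $\mu$, in all $q$-products and $q$-powers. For $0\le\ell\le j\le r$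 and $k\ge0$ put $$\kappa_{r,j,\ell}(k)=\frac{(-1)^{r-j}\,q^{\binom{r-j}{2}-j(r-j)-\ell(j-\ell)-jk}}{g_{r-j}(q^{r-j},1)\,g_{j-\ell}(q^{j-\ell},1)} .$$ *Codes.* A rank-metric code $C$ is an $F$-subspace of the $n\times m$ matrices over $F$, and $C^\perp=\{N:\operatorname{Tr}(MN^\top)=0\text{ for all }M\in C\}$. For a subspace $D\le C$, let $\operatorname{wt}(D)$ be the dimension of the sum of the column spaces of the matrices in $D$. The $r$-th higher rank-weight enumerator of $C$ is $$W_C^{(r)}(x,y)=\sum_{D\le C,\ \dim D=r}x^{\,n-\operatorname{wt}(D)}y^{\operatorname{wt}(D)}.$$ For $J\le E$ let $C(J)$ be the space of matrices in $C$ with column space contained in $J$, and let $P_C=(E,\rho_C)$ be the $(q,m)$-polymatroid with $\rho_C(J)=\dim C-\dim C(J^\perp)$. **Theorem.** For every $(q,m)$-polymatroid $P=(E,\rho)$ and every $r\ge0$, $$W_{P^*}^{(r)}(x,y)=\sum_{j=0}^{r}\sum_{\ell=0}^{j}\kappa_{r,j,\ell}(\rho(E))\;\overline{W_P^{(\ell)}}^{(mj)}\bigl(x+(q^{mj}-1)y,\;x-y\bigr).$$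 **Corollary.** Let $C$ be a rank-metric code in the space of $n\times m$ matrices over $F$. Then $W_{P_C}^{(r)}=W_C^{(r)}$ and $W_{P_C^*}^{(r)}=W_{C^\perp}^{(r)}$ for all $r\ge0$, and for all $0\le r\le nm-\dim C$, $$W_{C^\perp}^{(r)}(x,y)=\sum_{j=0}^{r}\ \sum_{\ell=0}^{\min\{j,\dim C\}}\kappa_{r,j,\ell}(\dim C)\;\overline{W_C^{(\ell)}}^{(mj)}\bigl(x+(q^{mj}-1)y,\;x-y\bigr).$$ -/

import Mathlib

open Module

/-! ## Gaussian coefficients and the products `g_ℓ` -/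

/-- `g_ℓ(X, Y) = ∏_{i < ℓ} (X - q^i Y)`, for elements `X`, `Y` of a commutative ring. -/
def gProd {R : Type*} [CommRing R] (q : R) (l : ℕ) (X Y : R) : R :=
  ∏ i ∈ Finset.range l, (X - q ^ i * Y)

/-- The Gaussian coefficient `[a choose b]_q` for an integer `a` and a natural number `b`. -/
noncomputable def qBinom (q : ℝ) (a : ℤ) (b : ℕ) : ℝ :=
  ∏ i ∈ Finset.range b, (q ^ (a - i) - 1) / (q ^ ((b : ℤ) - i) - 1)

/-! ## The `q`-product, the `q`-powers and the `q`-transform -/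

/-- A homogeneous polynomial `a(x, y; μ) = ∑_{i ≤ deg} a_i(μ) x^{deg - i} y^i`, whose
coefficients are real-valued functions of `μ`. The argument `μ` ranges over the integers because
the `q`-product shifts it. -/
structure ParamForm where
  deg : ℕ
  coeff : ℕ → ℤ → ℝ
  coeff_eq_zero : ∀ i, deg < i → ∀ μ, coeff i μ = 0

namespace ParamForm

/-- The constant form `1`, of degree `0`. -/
def one : ParamForm where
  deg := 0
  coeff i _ := if i = 0 then 1 else 0
  coeff_eq_zero i hi μ := if_neg (by omega)

/-- The linear form `α(μ) x + β(μ) y`. -/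
def linear (α β : ℤ → ℝ) : ParamForm where
  deg := 1
  coeff i μ := if i = 0 then α μ else if i = 1 then β μ else 0
  coeff_eq_zero i hi μ := by rw [if_neg (by omega), if_neg (by omega)]

/-- The `q`-product `a *_μ b`: with `s = deg b`, its coefficient of `x^{deg a + s - u} y^u` is
`c_u(μ) = ∑_{i ≤ u} q^{i s} a_i(μ) b_{u-i}(μ - i)`. -/
def qMul (q : ℝ) (a b : ParamForm) : ParamForm where
  deg := a.deg + b.deg
  coeff u μ := ∑ i ∈ Finset.range (u + 1), q ^ (i * b.deg) * a.coeff i μ * b.coeff (u - i) (μ - i)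
  coeff_eq_zero u hu μ := by
    refine Finset.sum_eq_zero fun i _ => ?_
    rcases lt_or_ge a.deg i with h | h
    · rw [a.coeff_eq_zero i h]; ring
    · rw [b.coeff_eq_zero (u - i) (by omega)]; ring

/-- The `q`-power `a^{⟨N⟩}`: `a^{⟨0⟩} = 1` and `a^{⟨N+1⟩} = a^{⟨N⟩} *_μ a`. -/
def qPow (q : ℝ) (a : ParamForm) : ℕ → ParamForm
  | 0 => one
  | N + 1 => qMul q (qPow q a N) a

/-- The polynomial in `x = X 0` and `y = X 1` obtained by specializing the parameter to `μ`. -/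
noncomputable def toPoly (a : ParamForm) (μ : ℤ) : MvPolynomial (Fin 2) ℝ :=
  ∑ i ∈ Finset.range (a.deg + 1),
    MvPolynomial.C (a.coeff i μ) * MvPolynomial.X 0 ^ (a.deg - i) * MvPolynomial.X 1 ^ i

end ParamForm

/-- The value at `(a, b)` of the `q`-transform of a homogeneous polynomial
`F = ∑_{i ≤ n} f_i x^{n-i} y^i` of degree `n`, namely `∑_{i ≤ n} f_i b^{⟨i⟩} *_μ a^{⟨n-i⟩}`. -/
noncomputable def qTransform (q : ℝ) (n : ℕ) (F : MvPolynomial (Fin 2) ℝ) (μ : ℤ)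
    (a b : ParamForm) : MvPolynomial (Fin 2) ℝ :=
  ∑ i ∈ Finset.range (n + 1),
    MvPolynomial.C (F.coeff (Finsupp.single 0 (n - i) + Finsupp.single 1 i)) *
      (ParamForm.qMul q (ParamForm.qPow q b i) (ParamForm.qPow q a (n - i))).toPoly μ

/-- The `q`-transform of `F` (homogeneous of degree `n`) with parameter `μ`, evaluated at
`(x + (q^μ - 1) y, x - y)`. Here `x + (q^μ - 1) y` is a form depending on `μ`. -/
noncomputable def qMacWilliams (q : ℝ) (n : ℕ) (F : MvPolynomial (Fin 2) ℝ) (μ : ℤ) :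
    MvPolynomial (Fin 2) ℝ :=
  qTransform q n F μ
    (ParamForm.linear (fun _ => 1) (fun ν => q ^ ν - 1))
    (ParamForm.linear (fun _ => 1) (fun _ => -1))

/-- The factor `(-1)^{r-j} q^{binom(r-j,2) - j(r-j) - ℓ(j-ℓ) - j k} /
(g_{r-j}(q^{r-j}, 1) g_{j-ℓ}(q^{j-ℓ}, 1))`, meant for `ℓ ≤ j ≤ r`. -/
noncomputable def macWilliamsCoeff (q : ℝ) (r j l k : ℕ) : ℝ :=
  (-1) ^ (r - j) *
    q ^ (((r - j).choose 2 : ℤ) - (j : ℤ) * ((r : ℤ) - j) - (l : ℤ) * ((j : ℤ) - l)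
      - (j : ℤ) * k) /
    (gProd q (r - j) (q ^ (r - j)) 1 * gProd q (j - l) (q ^ (j - l)) 1)

/-! ## Subspaces, orthogonality and `(q, m)`-polymatroids -/

/-- The finite set of all subspaces of a finite vector space. -/
noncomputable def subspaces (F V : Type*) [Field F] [AddCommGroup V] [Module F V] [Finite V] :
    Finset (Submodule F V) :=
  (Set.finite_univ (α := Submodule F V)).toFinset

/-- The orthogonal complement of `J` for the standard inner product. -/
def orth {F : Type*} [Field F] {n : ℕ} (J : Submodule F (Fin n → F)) :
    Submodule F (Fin n → F) where
  carrier := {y | ∀ x ∈ J, x ⬝ᵥ y = 0}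
  zero_mem' := fun x _ => dotProduct_zero x
  add_mem' := fun ha hb x hx => by rw [dotProduct_add, ha x hx, hb x hx, add_zero]
  smul_mem' := fun c y hy x hx => by rw [dotProduct_smul, hy x hx, smul_zero]

theorem orth_eq {F : Type*} [Field F] {n : ℕ} (J : Submodule F (Fin n → F)) :
    orth J = LinearMap.BilinForm.orthogonal (Matrix.toBilin' (1 : Matrix (Fin n) (Fin n) F)) J := by
  ext y
  rw [LinearMap.BilinForm.mem_orthogonal_iff]
  refine forall₂_congr fun x _ => ?_
  rw [Matrix.toBilin'_apply', Matrix.one_mulVec]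

theorem orth_nondeg {F : Type*} [Field F] {n : ℕ} :
    LinearMap.BilinForm.Nondegenerate (Matrix.toBilin' (1 : Matrix (Fin n) (Fin n) F)) :=
  LinearMap.BilinForm.nondegenerate_toBilin'_of_det_ne_zero' 1 (by simp)

theorem orth_refl {F : Type*} [Field F] {n : ℕ} :
    LinearMap.BilinForm.IsRefl (Matrix.toBilin' (1 : Matrix (Fin n) (Fin n) F)) := by
  intro x y h
  rw [Matrix.toBilin'_apply', Matrix.one_mulVec] at h ⊢
  rw [dotProduct_comm]; exact h

theorem finrank_orth {F : Type*} [Field F] {n : ℕ} (J : Submodule F (Fin n → F)) :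
    finrank F J + finrank F (orth J) = n := by
  have h := LinearMap.BilinForm.finrank_orthogonal (orth_nondeg (F := F) (n := n)) J
  have h' := Submodule.finrank_le J
  rw [← orth_eq, finrank_fin_fun] at h
  rw [finrank_fin_fun] at h'
  omega

theorem orth_orth {F : Type*} [Field F] {n : ℕ} (J : Submodule F (Fin n → F)) :
    orth (orth J) = J := by
  rw [orth_eq (orth J), orth_eq J]
  exact LinearMap.BilinForm.orthogonal_orthogonal orth_nondeg orth_refl J

theorem orth_anti {F : Type*} [Field F] {n : ℕ} {A B : Submodule F (Fin n → F)} (h : A ≤ B) :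
    orth B ≤ orth A := fun _ hy x hx => hy x (h hx)

theorem orth_sup {F : Type*} [Field F] {n : ℕ} (A B : Submodule F (Fin n → F)) :
    orth (A ⊔ B) = orth A ⊓ orth B := by
  refine le_antisymm (le_inf (orth_anti le_sup_left) (orth_anti le_sup_right)) ?_
  rintro y ⟨hA, hB⟩ x hx
  obtain ⟨a, ha, b, hb, rfl⟩ := Submodule.mem_sup.mp hx
  rw [add_dotProduct, hA a ha, hB b hb, add_zero]

theorem orth_inf {F : Type*} [Field F] {n : ℕ} (A B : Submodule F (Fin n → F)) :
    orth (A ⊓ B) = orth A ⊔ orth B := by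
  rw [← orth_orth (orth A ⊔ orth B), orth_sup, orth_orth, orth_orth]

/-- A `(q, m)`-polymatroid on `E = F^n`, where `F` is the field with `q` elements. -/
@[ext]
structure QMPolymatroid (F : Type*) [Field F] (n m : ℕ) where
  rank : Submodule F (Fin n → F) → ℕ
  rank_le : ∀ A, rank A ≤ m * finrank F A
  rank_mono : ∀ A B, A ≤ B → rank A ≤ rank B
  rank_submod : ∀ A B, rank (A ⊔ B) + rank (A ⊓ B) ≤ rank A + rank B

namespace QMPolymatroid

theorem rank_le_add {F : Type*} [Field F] {n m : ℕ} (P : QMPolymatroid F n m)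
    {A B : Submodule F (Fin n → F)} (h : A ≤ B) :
    P.rank B + m * finrank F A ≤ P.rank A + m * finrank F B := by
  obtain ⟨K, hK⟩ := exists_isCompl (Submodule.comap B.subtype A)
  have hsup : A ⊔ K.map B.subtype = B := by
    have := congrArg (Submodule.map B.subtype) hK.sup_eq_top
    rwa [Submodule.map_sup, Submodule.map_comap_subtype, Submodule.map_subtype_top,
      inf_eq_right.mpr h] at this
  have hdim := Submodule.finrank_add_eq_of_isCompl hK
  have e1 : finrank F (Submodule.comap B.subtype A) = finrank F A :=
    LinearEquiv.finrank_eq (Submodule.comapSubtypeEquivOfLe h)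
  have e2 : finrank F (K.map B.subtype) = finrank F K := Submodule.finrank_map_subtype_eq B K
  have h1 := P.rank_submod A (K.map B.subtype)
  have h2 := P.rank_le (K.map B.subtype)
  rw [hsup] at h1
  rw [e2] at h2
  rw [e1] at hdim
  rw [← hdim]
  nlinarith

/-- The dual `(q, m)`-polymatroid, `ρ*(J) = ρ(J^⊥) + m dim J - ρ(E)`. -/
noncomputable def dual {F : Type*} [Field F] {n m : ℕ} (P : QMPolymatroid F n m) : QMPolymatroid F n m where
  rank J := P.rank (orth J) + m * finrank F J - P.rank ⊤
  rank_le A := by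
    have := P.rank_mono _ _ (le_top : orth A ≤ ⊤)
    omega
  rank_mono A B h := by
    have h1 := P.rank_le_add (orth_anti h)
    have hA := congrArg (m * ·) (finrank_orth A)
    have hB := congrArg (m * ·) (finrank_orth B)
    simp only [mul_add] at hA hB
    omega
  rank_submod A B := by
    have key : ∀ J : Submodule F (Fin n → F),
        P.rank ⊤ ≤ P.rank (orth J) + m * finrank F J := by
      intro J
      have h1 := P.rank_le_add (le_top : orth J ≤ ⊤)
      have hJ := congrArg (m * ·) (finrank_orth J)
      rw [finrank_top, finrank_fin_fun] at h1
      simp only [mul_add] at hJ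
      omega
    have h1 := P.rank_submod (orth A) (orth B)
    have h2 := congrArg (m * ·) (Submodule.finrank_sup_add_finrank_inf_eq A B)
    simp only [mul_add] at h2
    have k1 := key A
    have k2 := key B
    have k3 := key (A ⊔ B)
    have k4 := key (A ⊓ B)
    rw [orth_sup, orth_inf] at *
    omega

/-- The `r`-th higher weight polynomial
`∑_{U ≤ E} [ρ(E) - ρ(U) choose r]_q y^{n - dim U} g_{dim U}(x, y)`, where `x = X 0`, `y = X 1`. -/
noncomputable def higherWeight {F : Type*} [Field F] [Fintype F] {n m : ℕ}
    (P : QMPolymatroid F n m) (r : ℕ) : MvPolynomial (Fin 2) ℝ :=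
  ∑ U ∈ subspaces F (Fin n → F),
    MvPolynomial.C (qBinom (Fintype.card F) ((P.rank ⊤ : ℤ) - P.rank U) r) *
      MvPolynomial.X 1 ^ (n - finrank F U) *
      gProd (Fintype.card F : MvPolynomial (Fin 2) ℝ) (finrank F U)
        (MvPolynomial.X 0) (MvPolynomial.X 1)

end QMPolymatroid

/-! ## Rank-metric codes -/

/-- The rank-support of a matrix: its column space. -/
def matSupp {F : Type*} [Field F] {n m : ℕ} (M : Matrix (Fin n) (Fin m) F) :
    Submodule F (Fin n → F) :=
  Submodule.span F (Set.range M.col)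

theorem matSupp_le_iff {F : Type*} [Field F] {n m : ℕ} (M : Matrix (Fin n) (Fin m) F)
    (J : Submodule F (Fin n → F)) : matSupp M ≤ J ↔ ∀ j, M.col j ∈ J := by
  rw [matSupp, Submodule.span_le, Set.range_subset_iff]; rfl

/-- The higher rank-support of a code. -/
def codeSupp {F : Type*} [Field F] {n m : ℕ} (D : Submodule F (Matrix (Fin n) (Fin m) F)) :
    Submodule F (Fin n → F) :=
  ⨆ M ∈ D, matSupp M

/-- The higher rank-weight of a code. -/
noncomputable def codeWt {F : Type*} [Field F] {n m : ℕ}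
    (D : Submodule F (Matrix (Fin n) (Fin m) F)) : ℕ :=
  finrank F (codeSupp D)

/-- The dual code for the trace inner product `M · N = Tr (M Nᵀ)`. -/
def codeDual {F : Type*} [Field F] {n m : ℕ} (C : Submodule F (Matrix (Fin n) (Fin m) F)) :
    Submodule F (Matrix (Fin n) (Fin m) F) where
  carrier := {N | ∀ M ∈ C, (M * N.transpose).trace = 0}
  zero_mem' := fun M _ => by simp
  add_mem' := fun {N N'} hN hN' M hM => by
    rw [Matrix.transpose_add, Matrix.mul_add, Matrix.trace_add, hN M hM, hN' M hM, add_zero]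
  smul_mem' := fun c N hN M hM => by
    rw [Matrix.transpose_smul, Matrix.mul_smul, Matrix.trace_smul, hN M hM, smul_zero]

open Classical in
/-- The `r`-th higher rank-weight enumerator
`∑ x^{n - wt D} y^{wt D}` over the `r`-dimensional subcodes `D` of `C`. -/
noncomputable def higherRankWeightEnum {F : Type*} [Field F] [Fintype F] {n m : ℕ}
    (C : Submodule F (Matrix (Fin n) (Fin m) F)) (r : ℕ) : MvPolynomial (Fin 2) ℝ :=
  ∑ D ∈ (subspaces F (Matrix (Fin n) (Fin m) F)).filter (fun D => D ≤ C ∧ finrank F D = r),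
    MvPolynomial.X 0 ^ (n - codeWt D) * MvPolynomial.X 1 ^ codeWt D

/-- The shortened code `C(J)`: the codewords of `C` whose support lies in `J`. -/
def codeShorten {F : Type*} [Field F] {n m : ℕ} (C : Submodule F (Matrix (Fin n) (Fin m) F))
    (J : Submodule F (Fin n → F)) : Submodule F (Matrix (Fin n) (Fin m) F) where
  carrier := {M | M ∈ C ∧ matSupp M ≤ J}
  zero_mem' := ⟨C.zero_mem, (matSupp_le_iff _ _).2 fun _ => J.zero_mem⟩
  add_mem' := fun ha hb => ⟨C.add_mem ha.1 hb.1, (matSupp_le_iff _ _).2 fun j =>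
    J.add_mem ((matSupp_le_iff _ _).1 ha.2 j) ((matSupp_le_iff _ _).1 hb.2 j)⟩
  smul_mem' := fun c _ ha => ⟨C.smul_mem c ha.1, (matSupp_le_iff _ _).2 fun j =>
    J.smul_mem c ((matSupp_le_iff _ _).1 ha.2 j)⟩

theorem codeShorten_mono {F : Type*} [Field F] {n m : ℕ}
    (C : Submodule F (Matrix (Fin n) (Fin m) F)) {A B : Submodule F (Fin n → F)} (h : A ≤ B) :
    codeShorten C A ≤ codeShorten C B := fun _ hM => ⟨hM.1, hM.2.trans h⟩

theorem finrank_codeShorten_ge {F : Type*} [Field F] {n m : ℕ}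
    (C : Submodule F (Matrix (Fin n) (Fin m) F)) (J : Submodule F (Fin n → F)) :
    finrank F C ≤ finrank F (codeShorten C (orth J)) + m * finrank F J := by
  let ψ : C →ₗ[F] (J →ₗ[F] (Fin m → F)) :=
    (LinearMap.lcomp F (Fin m → F) J.subtype) ∘ₗ
      (Matrix.vecMulBilin F F : (Fin n → F) →ₗ[F] Matrix (Fin n) (Fin m) F →ₗ[F] _).flip ∘ₗ
      C.subtype
  have hker : codeShorten C (orth J) = (LinearMap.ker ψ).map C.subtype := by
    ext M
    constructor
    · rintro ⟨hM, hs⟩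
      refine ⟨⟨M, hM⟩, ?_, rfl⟩
      refine LinearMap.mem_ker.2 (LinearMap.ext fun x => funext fun j => ?_)
      exact (matSupp_le_iff _ _).1 hs j x x.2
    · rintro ⟨⟨M, hM⟩, hk, rfl⟩
      refine ⟨hM, (matSupp_le_iff _ _).2 fun j x hx => ?_⟩
      exact congrFun (LinearMap.congr_fun (LinearMap.mem_ker.1 hk) ⟨x, hx⟩) j
  have h1 := LinearMap.finrank_range_add_finrank_ker ψ
  have h2 := Submodule.finrank_le (LinearMap.range ψ)
  have h3 : finrank F (J →ₗ[F] (Fin m → F)) = finrank F J * m := by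
    rw [finrank_linearMap, finrank_fin_fun]
  rw [hker, Submodule.finrank_map_subtype_eq]
  rw [h3, mul_comm] at h2
  omega

/-- The `(q, m)`-polymatroid `P_C` of a rank-metric code, `ρ_C(J) = dim C - dim C(J^⊥)`. -/
noncomputable def codePolymatroid {F : Type*} [Field F] {n m : ℕ}
    (C : Submodule F (Matrix (Fin n) (Fin m) F)) : QMPolymatroid F n m where
  rank J := finrank F C - finrank F (codeShorten C (orth J))
  rank_le J := by
    have := finrank_codeShorten_ge C J
    omega
  rank_mono A B h := by
    have := Submodule.finrank_mono (codeShorten_mono C (orth_anti h))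
    omega
  rank_submod A B := by
    have hle : ∀ J, finrank F (codeShorten C J) ≤ finrank F C := fun J =>
      Submodule.finrank_mono fun _ hM => hM.1
    have h1 := Submodule.finrank_sup_add_finrank_inf_eq
      (codeShorten C (orth A)) (codeShorten C (orth B))
    have h2 : finrank F ↥(codeShorten C (orth A) ⊔ codeShorten C (orth B)) ≤
        finrank F (codeShorten C (orth A ⊔ orth B)) :=
      Submodule.finrank_mono (sup_le (codeShorten_mono C le_sup_left)
        (codeShorten_mono C le_sup_right))
    have h3 : codeShorten C (orth A) ⊓ codeShorten C (orth B) =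
        codeShorten C (orth A ⊓ orth B) := by
      ext M
      exact ⟨fun h => ⟨h.1.1, le_inf h.1.2 h.2.2⟩,
        fun h => ⟨⟨h.1, h.2.trans inf_le_left⟩, ⟨h.1, h.2.trans inf_le_right⟩⟩⟩
    rw [h3] at h1
    rw [orth_sup, orth_inf]
    have k1 := hle (orth A)
    have k2 := hle (orth B)
    have k3 := hle (orth A ⊔ orth B)
    have k4 := hle (orth A ⊓ orth B)
    omega

/-! The polynomials `y^(n-d) g_d(x,y)` are adapted to the q-transform: with parameter `μ` it is
linear and sends `y^(n-d) g_d` to `q^(μ d) y^d g_(n-d)` (`qMacWilliams_gProd`). Passing from `U` to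
its orthogonal complement in the definition of the dual weight polynomial produces the same `y^d
g_(n-d)`, where `d = dim U`, and turns the Gaussian coefficient into `[m d - ρ(U) choose r]`, since
`ρ*(E) - ρ*(U^⊥) = m d - ρ(U)` (`QMPolymatroid.dual_rank_sub`). With `μ = m j`, the theorem
therefore reduces, one subspace `U` at a time, to the numerical identity `qBinom_sub_eq_sum`, which
writes `[a - b choose r]` as a combination of the products `[k - b choose l] q^(a j)`. That identity
is two changes of basis: `g_r` into powers (`sum_gCoeff`), then powers back into the `g_l`
(`sum_gaussBinom_gProd`).

For the transform of `g_d` alone, Pascal's rule lets `d` grow by one q-multiplication on the right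
by `x + (q^μ - 1) y` and one on the left by `x - y`; associativity of the q-product gives `q^(μ d)
y^d` by induction (`sum_gCoeff_qMulCoeff`).

For a code, `[ρ(E) - ρ(U) choose r]` counts the `r`-dimensional subcodes supported in `U^⊥`.
Exchanging the sums over subcodes and over `U` gives `codePolymatroid_higherWeight`;
`dual_codePolymatroid` identifies the dual polymatroid with that of the dual code. -/

/-! ## Gaussian coefficients -/

section Gauss

variable {R : Type*} [CommRing R]

/-- Gaussian coefficients of natural numbers, by the `q`-Pascal recursion. -/
def gaussBinom (q : R) : ℕ → ℕ → R
  | _, 0 => 1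
  | 0, _ + 1 => 0
  | n + 1, k + 1 => gaussBinom q n k + q ^ (k + 1) * gaussBinom q n (k + 1)

/-- The coefficient of `X ^ (d - l) * Y ^ l` in `gProd q d X Y`. -/
def gCoeff (q : R) : ℕ → ℕ → R
  | 0, 0 => 1
  | 0, _ + 1 => 0
  | d + 1, 0 => gCoeff q d 0
  | d + 1, l + 1 => gCoeff q d (l + 1) - q ^ d * gCoeff q d l

theorem gaussBinom_zero_right (q : R) (n : ℕ) : gaussBinom q n 0 = 1 := by
  cases n <;> rfl

theorem gaussBinom_succ_succ (q : R) (n k : ℕ) :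
    gaussBinom q (n + 1) (k + 1) = gaussBinom q n k + q ^ (k + 1) * gaussBinom q n (k + 1) := rfl

theorem gaussBinom_eq_zero (q : R) : ∀ {n k : ℕ}, n < k → gaussBinom q n k = 0
  | 0, _ + 1, _ => rfl
  | n + 1, k + 1, h => by
    rw [gaussBinom_succ_succ, gaussBinom_eq_zero q (by omega), gaussBinom_eq_zero q (by omega)]
    ring

theorem gCoeff_zero_right (q : R) : ∀ d, gCoeff q d 0 = 1
  | 0 => rfl
  | d + 1 => gCoeff_zero_right q d

theorem gCoeff_succ_succ (q : R) (d l : ℕ) :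
    gCoeff q (d + 1) (l + 1) = gCoeff q d (l + 1) - q ^ d * gCoeff q d l := rfl

theorem gCoeff_eq_zero (q : R) : ∀ {d l : ℕ}, d < l → gCoeff q d l = 0
  | 0, _ + 1, _ => rfl
  | d + 1, l + 1, h => by
    rw [gCoeff_succ_succ, gCoeff_eq_zero q (by omega), gCoeff_eq_zero q (by omega)]
    ring

/-- The second Pascal rule. It matches the recursion of `gaussBinom`, and it is what
q-multiplication on the right by `x - y` produces; the defining rule corresponds to multiplication
on the left. -/
theorem gCoeff_succ_succ' (q : R) : ∀ d l : ℕ,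
    gCoeff q (d + 1) (l + 1) = q ^ (l + 1) * gCoeff q d (l + 1) - q ^ l * gCoeff q d l
  | 0, 0 => by simp [gCoeff]
  | 0, l + 1 => by simp [gCoeff]
  | d + 1, 0 => by
    have h := gCoeff_succ_succ' q d 0
    have h' := gCoeff_succ_succ q d 0
    rw [gCoeff_succ_succ]
    rw [gCoeff_zero_right] at *
    linear_combination h - q * h'
  | d + 1, l + 1 => by
    rw [gCoeff_succ_succ q (d + 1)]
    linear_combination gCoeff_succ_succ' q d (l + 1) - q ^ (d + 1) * gCoeff_succ_succ' q d l -
      q ^ (l + 2) * gCoeff_succ_succ q d (l + 1) + q ^ (l + 1) * gCoeff_succ_succ q d l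

theorem gCoeff_eq (q : R) : ∀ d l : ℕ,
    gCoeff q d l = (-1) ^ l * q ^ l.choose 2 * gaussBinom q d l
  | 0, 0 => by simp [gCoeff, gaussBinom]
  | 0, l + 1 => by simp [gCoeff, gaussBinom]
  | d + 1, 0 => by simp [gCoeff_zero_right, gaussBinom_zero_right]
  | d + 1, l + 1 => by
    rw [gCoeff_succ_succ', gCoeff_eq q d, gCoeff_eq q d, gaussBinom_succ_succ,
      Nat.choose_succ_succ' l 1, Nat.choose_one_right]
    ring

theorem gProd_succ (q : R) (l : ℕ) (X Y : R) :
    gProd q (l + 1) X Y = gProd q l X Y * (X - q ^ l * Y) := Finset.prod_range_succ _ _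

theorem sum_gCoeff (q X Y : R) (d : ℕ) :
    ∑ l ∈ Finset.range (d + 1), gCoeff q d l * X ^ (d - l) * Y ^ l = gProd q d X Y := by
  induction d with
  | zero => simp [gCoeff, gProd]
  | succ d ih =>
    rw [gProd_succ, ← ih, Finset.sum_range_succ', mul_sub, Finset.sum_mul, Finset.sum_mul]
    simp only [gCoeff_succ_succ, gCoeff_zero_right, Nat.add_sub_add_right, sub_mul,
      Finset.sum_sub_distrib]
    have h1 : ∑ l ∈ Finset.range (d + 1), gCoeff q d l * X ^ (d - l) * Y ^ l * X =
        ∑ l ∈ Finset.range (d + 1), gCoeff q d (l + 1) * X ^ (d - l) * Y ^ (l + 1) +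
          1 * X ^ (d + 1 - 0) * Y ^ 0 := by
      have := Finset.sum_range_succ' (fun l => gCoeff q d l * X ^ (d + 1 - l) * Y ^ l) (d + 1)
      simp only [gCoeff_zero_right, Nat.add_sub_add_right] at this
      rw [← this, Finset.sum_range_succ _ (d + 1), gCoeff_eq_zero q (Nat.lt_succ_self d)]
      rw [zero_mul, zero_mul, add_zero]
      refine Finset.sum_congr rfl fun l hl => ?_
      rw [Nat.sub_add_comm (by simpa [Nat.lt_succ_iff] using hl), pow_succ]
      ring
    rw [h1, sub_add_eq_add_sub]
    congr 1
    exact Finset.sum_congr rfl fun l _ => by ring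

/-- Inverse of the expansion `sum_gCoeff`. In the induction each term is multiplied by `X = (X - q^l
Y) + q^l Y`: the first part raises `g_l` to `g_(l+1)`, the second raises the power of `Y`, and
Pascal's rule collects them. -/
theorem sum_gaussBinom_gProd (q X Y : R) (j : ℕ) :
    ∑ l ∈ Finset.range (j + 1), gaussBinom q j l * Y ^ (j - l) * gProd q l X Y = X ^ j := by
  induction j with
  | zero => simp [gaussBinom, gProd]
  | succ j ih =>
    rw [pow_succ, ← ih, Finset.sum_mul, Finset.sum_range_succ']
    simp only [gaussBinom_succ_succ, gaussBinom_zero_right, Nat.add_sub_add_right, add_mul,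
      Finset.sum_add_distrib]
    have h1 : ∑ l ∈ Finset.range (j + 1),
          q ^ (l + 1) * gaussBinom q j (l + 1) * Y ^ (j - l) * gProd q (l + 1) X Y +
          1 * Y ^ (j + 1 - 0) * gProd q 0 X Y =
        ∑ l ∈ Finset.range (j + 1), q ^ l * gaussBinom q j l * Y ^ (j + 1 - l) *
          gProd q l X Y := by
      have := Finset.sum_range_succ' (fun l => q ^ l * gaussBinom q j l * Y ^ (j + 1 - l) *
          gProd q l X Y) (j + 1)
      rw [Finset.sum_range_succ, gaussBinom_eq_zero q (Nat.lt_succ_self j)] at this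
      simp only [gaussBinom_zero_right, Nat.add_sub_add_right, pow_zero, one_mul, mul_zero,
        zero_mul, add_zero] at this ⊢
      exact this.symm
    rw [add_assoc, h1, ← Finset.sum_add_distrib]
    refine Finset.sum_congr rfl fun l hl => ?_
    rw [Nat.sub_add_comm (by simpa [Nat.lt_succ_iff] using hl), pow_succ, gProd_succ]
    ring

/-- The product formula for Gaussian coefficients, kept free of division so that it holds in any
commutative ring. -/
theorem gaussBinom_mul_gProd (q : R) : ∀ n k : ℕ,
    gaussBinom q n k * gProd q k (q ^ k) 1 = gProd q k (q ^ n) 1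
  | n, 0 => by simp [gaussBinom_zero_right, gProd]
  | 0, k + 1 => by
    rw [gaussBinom_eq_zero q (Nat.succ_pos k), zero_mul, eq_comm]
    exact Finset.prod_eq_zero (Finset.mem_range.2 (Nat.succ_pos k)) (by simp)
  | n + 1, k + 1 => by
    have hstep : ∀ n, gProd q (k + 1) (q ^ (n + 1)) 1 =
        q ^ k * (q ^ (n + 1) - 1) * gProd q k (q ^ n) 1 := fun n => by
      rw [gProd, Finset.prod_range_succ', gProd,
        Finset.prod_congr rfl (g := fun i => q * (q ^ n - q ^ i * 1)) fun i _ => by ring,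
        Finset.prod_mul_distrib, Finset.prod_const, Finset.card_range]
      ring
    have h1 := gaussBinom_mul_gProd q n (k + 1)
    have h2 := gaussBinom_mul_gProd q n k
    rw [gaussBinom_succ_succ, add_mul, mul_assoc, h1, hstep k, hstep n,
      mul_left_comm, h2, gProd_succ]
    ring

/-- Split the product after `k` factors: the first ones form `g_k(q^n, 1)`, and each later factor is
`q^n - q^(k+i) = q^k (q^(n-k) - q^i)`. -/
theorem gProd_self_eq (q : R) {n k : ℕ} (h : k ≤ n) :
    gProd q n (q ^ n) 1 =
      gaussBinom q n k * gProd q k (q ^ k) 1 * gProd q (n - k) (q ^ (n - k)) 1 *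
        q ^ (k * (n - k)) := by
  obtain ⟨d, rfl⟩ := Nat.exists_eq_add_of_le h
  rw [gaussBinom_mul_gProd, Nat.add_sub_cancel_left, gProd, Finset.prod_range_add, gProd, mul_assoc]
  congr 1
  have hpow : q ^ (k * d) = ∏ _i ∈ Finset.range d, q ^ k := by
    rw [Finset.prod_const, Finset.card_range, pow_mul]
  rw [gProd, hpow, ← Finset.prod_mul_distrib]
  exact Finset.prod_congr rfl fun i _ => by ring

theorem map_gCoeff {S : Type*} [CommRing S] (f : R →+* S) (q : R) : ∀ d l : ℕ,
    f (gCoeff q d l) = gCoeff (f q) d l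
  | 0, 0 => by simp [gCoeff]
  | 0, l + 1 => by simp [gCoeff]
  | d + 1, 0 => map_gCoeff f q d 0
  | d + 1, l + 1 => by simp [gCoeff_succ_succ, map_gCoeff f q d]

theorem map_gaussBinom {S : Type*} [CommRing S] (f : R →+* S) (q : R) : ∀ d l : ℕ,
    f (gaussBinom q d l) = gaussBinom (f q) d l
  | d, 0 => by simp [gaussBinom_zero_right]
  | 0, l + 1 => by simp [gaussBinom]
  | d + 1, l + 1 => by simp [gaussBinom_succ_succ, map_gaussBinom f q d]

end Gauss

/-! ### Gaussian coefficients with integer upper entry, and the numerical identity. -/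

section Real

variable {q : ℝ}

theorem gProd_self_ne_zero (hq : 1 < q) (n : ℕ) : gProd q n (q ^ n) 1 ≠ 0 := by
  refine Finset.prod_ne_zero_iff.2 fun i hi => ?_
  have := pow_lt_pow_right₀ hq (Finset.mem_range.1 hi)
  linarith

theorem qBinom_eq (hq : 1 < q) (a : ℤ) (b : ℕ) :
    qBinom q a b = gProd q b (q ^ a) 1 / gProd q b (q ^ b) 1 := by
  have h0 : q ≠ 0 := by positivity
  rw [qBinom, gProd, gProd, ← Finset.prod_div_distrib]
  refine Finset.prod_congr rfl fun i _ => ?_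
  rw [zpow_sub₀ h0, zpow_sub₀ h0, zpow_natCast, zpow_natCast, mul_one,
    div_sub_one (pow_ne_zero _ h0), div_sub_one (pow_ne_zero _ h0),
    div_div_div_cancel_right₀ (pow_ne_zero _ h0)]

theorem qBinom_natCast (hq : 1 < q) (n k : ℕ) : qBinom q n k = gaussBinom q n k := by
  rw [qBinom_eq hq, zpow_natCast, ← gaussBinom_mul_gProd,
    mul_div_cancel_right₀ _ (gProd_self_ne_zero hq k)]

/-- This is `sum_gaussBinom_gProd` at `X = q^c`, `Y = 1`, divided by `g_j(q^j, 1)`. -/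
theorem sum_qBinom (hq : 1 < q) (c : ℤ) (j : ℕ) :
    ∑ l ∈ Finset.range (j + 1),
      q ^ (-((l : ℤ) * ((j : ℤ) - l))) / gProd q (j - l) (q ^ (j - l)) 1 * qBinom q c l =
      (q ^ c) ^ j / gProd q j (q ^ j) 1 := by
  have h0 : q ≠ 0 := by positivity
  rw [← sum_gaussBinom_gProd q (q ^ c) 1 j, Finset.sum_div]
  refine Finset.sum_congr rfl fun l hl => ?_
  have hl : l ≤ j := by simpa [Nat.lt_succ_iff] using hl
  have h1 := gProd_self_ne_zero hq j
  have h2 := gProd_self_ne_zero hq l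
  have h3 := gProd_self_ne_zero hq (j - l)
  have e : q ^ (-((l : ℤ) * ((j : ℤ) - l))) = (q ^ (l * (j - l)))⁻¹ := by
    rw [zpow_neg, ← zpow_natCast]; push_cast [hl]; rfl
  have h4 : q ^ (l * (j - l)) ≠ 0 := pow_ne_zero _ h0
  rw [qBinom_eq hq, e, one_pow, mul_one]
  have := gProd_self_eq q hl
  field_simp
  rw [this]; ring

/-- Expand `g_r(q^(a-b), 1)` in powers of `q^(a-b)`, write `(q^(a-b))^j = q^(a j) q^(-j k)
(q^(k-b))^j`, and expand the last power by `sum_qBinom`. The auxiliary `k` drops out of the total.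
-/
theorem qBinom_sub_eq_sum (hq : 1 < q) (a b : ℤ) (k r : ℕ) :
    qBinom q (a - b) r = ∑ j ∈ Finset.range (r + 1), ∑ l ∈ Finset.range (j + 1),
      macWilliamsCoeff q r j l k * (qBinom q (k - b) l * q ^ (a * j)) := by
  have h0 : q ≠ 0 := by positivity
  -- The reflection makes `j` the exponent of `q^(a-b)`, so the coefficient involved is `gCoeff q r
  -- (r - j)`.
  rw [qBinom_eq hq, ← sum_gCoeff, Finset.sum_div, ← Finset.sum_range_reflect]
  refine Finset.sum_congr rfl fun j hj => ?_
  have hj : j ≤ r := by simpa [Nat.lt_succ_iff] using hj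
  have hin := sum_qBinom hq (k - b) j
  have hsum : ∑ l ∈ Finset.range (j + 1),
        macWilliamsCoeff q r j l k * (qBinom q (k - b) l * q ^ (a * j)) =
      (-1) ^ (r - j) * q ^ (((r - j).choose 2 : ℤ) - (j : ℤ) * ((r : ℤ) - j) - (j : ℤ) * k) /
        gProd q (r - j) (q ^ (r - j)) 1 * q ^ (a * j) *
        ((q ^ ((k : ℤ) - b)) ^ j / gProd q j (q ^ j) 1) := by
    rw [← hin, Finset.mul_sum]
    refine Finset.sum_congr rfl fun l _ => ?_
    have : (((r - j).choose 2 : ℤ) - (j : ℤ) * ((r : ℤ) - j) - (l : ℤ) * ((j : ℤ) - l)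
        - (j : ℤ) * k) = (((r - j).choose 2 : ℤ) - (j : ℤ) * ((r : ℤ) - j) - (j : ℤ) * k) +
        (-((l : ℤ) * ((j : ℤ) - l))) := by ring
    rw [macWilliamsCoeff, this, zpow_add₀ h0]
    have h2 := gProd_self_ne_zero hq (j - l)
    have h3 := gProd_self_ne_zero hq (r - j)
    field_simp
  have e1 : r + 1 - 1 - j = r - j := by omega
  have e2 : r - (r - j) = j := by omega
  rw [hsum, e1, e2, gCoeff_eq, one_pow, mul_one]
  have h1 := gProd_self_ne_zero hq r
  have h2 := gProd_self_ne_zero hq j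
  have h3 := gProd_self_ne_zero hq (r - j)
  have hg := gProd_self_eq q (Nat.sub_le r j)
  rw [e2] at hg
  have e : q ^ (((r - j).choose 2 : ℤ) - (j : ℤ) * ((r : ℤ) - j) - (j : ℤ) * k) * q ^ (a * j) *
      (q ^ ((k : ℤ) - b)) ^ j * q ^ ((r - j) * j) =
      q ^ ((r - j).choose 2) * (q ^ (a - b)) ^ j := by
    simp only [← zpow_natCast, ← zpow_mul, ← zpow_add₀ h0]
    congr 1
    push_cast [hj]
    ring
  field_simp
  rw [hg]
  linear_combination (-(gaussBinom q r (r - j)) * gProd q j (q ^ j) 1 * gProd q (r - j) (q ^ (r - j)) 1) * e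

end Real

/-! ## The `q`-transform of `y ^ (n - d) * g_d(x, y)` -/

section QProduct

/-- The coefficients of a `q`-product whose right factor has degree `s`. -/
def qMulCoeff (q : ℝ) (s : ℕ) (a b : ℕ → ℤ → ℝ) (u : ℕ) (μ : ℤ) : ℝ :=
  ∑ i ∈ Finset.range (u + 1), q ^ (i * s) * a i μ * b (u - i) (μ - i)

theorem qMulCoeff_eq_antidiagonal (q : ℝ) (s : ℕ) (a b : ℕ → ℤ → ℝ) (u : ℕ) (μ : ℤ) :
    qMulCoeff q s a b u μ =
      ∑ p ∈ Finset.HasAntidiagonal.antidiagonal u, q ^ (p.1 * s) * a p.1 μ * b p.2 (μ - p.1) :=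
  (Finset.Nat.sum_antidiagonal_eq_sum_range_succ
    (fun i j => q ^ (i * s) * a i μ * b j (μ - i)) u).symm

/-- Both bracketings sum `q^(k(s+t) + l t) a_k(μ) b_l(μ-k) c_j(μ-k-l)` over `k + l + j = u`. -/
theorem qMulCoeff_assoc (q : ℝ) (s t : ℕ) (a b c : ℕ → ℤ → ℝ) :
    qMulCoeff q t (qMulCoeff q s a b) c = qMulCoeff q (s + t) a (qMulCoeff q t b c) := by
  funext u μ
  simp only [qMulCoeff_eq_antidiagonal, Finset.mul_sum, Finset.sum_mul, Finset.sum_sigma']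
  refine Finset.sum_nbij' (fun x => ⟨(x.2.1, x.2.2 + x.1.2), (x.2.2, x.1.2)⟩)
    (fun x => ⟨(x.1.1 + x.2.1, x.2.2), (x.1.1, x.2.1)⟩) ?_ ?_ ?_ ?_ ?_
  · rintro ⟨⟨i, j⟩, k, l⟩ h
    simp only [Finset.mem_sigma, Finset.HasAntidiagonal.mem_antidiagonal, and_true] at h ⊢
    omega
  · rintro ⟨⟨i, j⟩, k, l⟩ h
    simp only [Finset.mem_sigma, Finset.HasAntidiagonal.mem_antidiagonal, and_true] at h ⊢
    omega
  · rintro ⟨⟨i, j⟩, k, l⟩ h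
    simp only [Finset.mem_sigma, Finset.HasAntidiagonal.mem_antidiagonal] at h
    obtain ⟨-, rfl⟩ := h
    rfl
  · rintro ⟨⟨i, j⟩, k, l⟩ h
    simp only [Finset.mem_sigma, Finset.HasAntidiagonal.mem_antidiagonal] at h
    obtain ⟨-, rfl⟩ := h
    rfl
  · rintro ⟨⟨i, j⟩, k, l⟩ h
    simp only [Finset.mem_sigma, Finset.HasAntidiagonal.mem_antidiagonal] at h
    obtain ⟨-, rfl⟩ := h
    have : μ - ((k + l : ℕ) : ℤ) = μ - k - l := by push_cast; ring
    simp only [this]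
    ring

theorem qMulCoeff_sum_left (q : ℝ) (s : ℕ) {ι : Type*} (K : Finset ι) (c : ι → ℝ)
    (a : ι → ℕ → ℤ → ℝ) (b : ℕ → ℤ → ℝ) (u : ℕ) (μ : ℤ) :
    ∑ k ∈ K, c k * qMulCoeff q s (a k) b u μ =
      qMulCoeff q s (fun u μ => ∑ k ∈ K, c k * a k u μ) b u μ := by
  simp only [qMulCoeff, Finset.mul_sum, Finset.sum_mul]
  rw [Finset.sum_comm]
  exact Finset.sum_congr rfl fun _ _ => Finset.sum_congr rfl fun _ _ => by ring

theorem qMulCoeff_sum_right (q : ℝ) (s : ℕ) {ι : Type*} (K : Finset ι) (c : ι → ℝ)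
    (a : ℕ → ℤ → ℝ) (b : ι → ℕ → ℤ → ℝ) (u : ℕ) (μ : ℤ) :
    ∑ k ∈ K, c k * qMulCoeff q s a (b k) u μ =
      qMulCoeff q s a (fun u μ => ∑ k ∈ K, c k * b k u μ) u μ := by
  simp only [qMulCoeff, Finset.mul_sum]
  rw [Finset.sum_comm]
  exact Finset.sum_congr rfl fun _ _ => Finset.sum_congr rfl fun _ _ => by ring

theorem qMulCoeff_linear_left (q : ℝ) (s : ℕ) (α β : ℤ → ℝ) (b : ℕ → ℤ → ℝ) (u : ℕ) (μ : ℤ) :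
    qMulCoeff q s (ParamForm.linear α β).coeff b (u + 1) μ =
      α μ * b (u + 1) μ + q ^ s * β μ * b u (μ - 1) := by
  rw [qMulCoeff, Finset.sum_range_succ', Finset.sum_range_succ', Finset.sum_eq_zero]
  · simp [ParamForm.linear]; ring
  · intro i _; simp [ParamForm.linear]

theorem qMulCoeff_linear_left_zero (q : ℝ) (s : ℕ) (α β : ℤ → ℝ) (b : ℕ → ℤ → ℝ) (μ : ℤ) :
    qMulCoeff q s (ParamForm.linear α β).coeff b 0 μ = α μ * b 0 μ := by
  simp [qMulCoeff, ParamForm.linear]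

theorem qMulCoeff_linear_right (q : ℝ) (s : ℕ) (α β : ℤ → ℝ) (a : ℕ → ℤ → ℝ) (u : ℕ) (μ : ℤ) :
    qMulCoeff q s a (ParamForm.linear α β).coeff (u + 1) μ =
      q ^ ((u + 1) * s) * a (u + 1) μ * α (μ - (u + 1 : ℕ)) +
        q ^ (u * s) * a u μ * β (μ - u) := by
  rw [qMulCoeff, Finset.sum_range_succ, Finset.sum_range_succ, Finset.sum_eq_zero]
  · simp [ParamForm.linear]; ring
  · intro i hi
    have : i < u := Finset.mem_range.1 hi
    simp [ParamForm.linear, show u + 1 - i ≠ 0 by omega, show u + 1 - i ≠ 1 by omega]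

theorem qMulCoeff_linear_right_zero (q : ℝ) (s : ℕ) (α β : ℤ → ℝ) (a : ℕ → ℤ → ℝ) (μ : ℤ) :
    qMulCoeff q s a (ParamForm.linear α β).coeff 0 μ = a 0 μ * α μ := by
  simp [qMulCoeff, ParamForm.linear]

variable (q : ℝ)

theorem deg_qPow_linear (α β : ℤ → ℝ) : ∀ N, (ParamForm.qPow q (ParamForm.linear α β) N).deg = N
  | 0 => rfl
  | N + 1 => congrArg (· + 1) (deg_qPow_linear α β N)

/-- The coefficients of the `q`-power of a linear form. -/
def powCoeff (α β : ℤ → ℝ) (N : ℕ) : ℕ → ℤ → ℝ :=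
  (ParamForm.qPow q (ParamForm.linear α β) N).coeff

theorem powCoeff_succ (α β : ℤ → ℝ) (N : ℕ) : powCoeff q α β (N + 1) =
    qMulCoeff q 1 (powCoeff q α β N) (ParamForm.linear α β).coeff := rfl

theorem qMulCoeff_powCoeff (α β : ℤ → ℝ) (N : ℕ) : ∀ l,
    qMulCoeff q l (powCoeff q α β N) (powCoeff q α β l) = powCoeff q α β (N + l)
  | 0 => by
    funext u μ
    rw [qMulCoeff, Finset.sum_range_succ, Finset.sum_eq_zero]
    · simp [powCoeff, ParamForm.qPow, ParamForm.one]
    · intro i hi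
      have := Finset.mem_range.1 hi
      simp [powCoeff, ParamForm.qPow, ParamForm.one, show u - i ≠ 0 by omega]
  | l + 1 => by
    rw [powCoeff_succ, ← qMulCoeff_assoc, qMulCoeff_powCoeff α β N l]; rfl

/-- The coefficients of the `q`-powers of `x - y`. -/
theorem powCoeff_sub (N : ℕ) :
    powCoeff q (fun _ => 1) (fun _ => -1) N = fun u _ => gCoeff q N u := by
  induction N with
  | zero =>
    funext u μ
    cases u <;> simp [powCoeff, ParamForm.qPow, ParamForm.one, gCoeff]
  | succ N ih =>
    funext u μ
    rw [powCoeff_succ, ih]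
    cases u with
    | zero => rw [qMulCoeff_linear_right_zero, gCoeff_zero_right, gCoeff_zero_right, one_mul]
    | succ u => rw [qMulCoeff_linear_right, gCoeff_succ_succ']; ring

theorem qMulCoeff_sub_powCoeff (l : ℕ) :
    qMulCoeff q l (ParamForm.linear (fun _ => 1) (fun _ => -1)).coeff
      (powCoeff q (fun _ => 1) (fun _ => -1) l) = powCoeff q (fun _ => 1) (fun _ => -1) (l + 1) := by
  rw [powCoeff_sub, powCoeff_sub]
  funext u μ
  cases u with
  | zero => rw [qMulCoeff_linear_left_zero, gCoeff_zero_right, gCoeff_zero_right, one_mul]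
  | succ u =>
    rw [qMulCoeff_linear_left, gCoeff_succ_succ]; ring

/-- The q-transform of `g_d` is `q^(μ d) y^d`. Writing `T_d` for it, `b = x - y` and `a = x + (q^μ -
1) y`, Pascal's rule for `gCoeff` and associativity give `T_(d+1) = T_d * a - q^d (b * T_d)`. -/
theorem sum_gCoeff_qMulCoeff {q : ℝ} (hq : q ≠ 0) (d : ℕ) :
    (fun u μ => ∑ l ∈ Finset.range (d + 1), gCoeff q d l *
      qMulCoeff q (d - l) (powCoeff q (fun _ => 1) (fun _ => -1) l)
        (powCoeff q (fun _ => 1) (fun ν => q ^ ν - 1) (d - l)) u μ) =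
      fun u (μ : ℤ) => if u = d then q ^ (μ * d) else 0 := by
  induction d with
  | zero =>
    funext u μ
    rw [Finset.sum_range_one]
    cases u with
    | zero => simp [gCoeff, qMulCoeff, powCoeff, ParamForm.qPow, ParamForm.one]
    | succ u =>
      simp only [Nat.add_eq_zero_iff, one_ne_zero, and_false, if_false]
      rw [qMulCoeff, Finset.sum_eq_zero, mul_zero]
      intro i _
      simp only [powCoeff, ParamForm.qPow, ParamForm.one]
      by_cases hi : i = 0
      · simp [hi, ParamForm.qPow, ParamForm.one]
      · simp [hi, ParamForm.qPow, ParamForm.one]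
  | succ d ih =>
    funext u μ
    set B := powCoeff q (fun _ => 1) (fun _ => -1) with hB
    set A := powCoeff q (fun _ => 1) (fun ν => q ^ ν - 1) with hA
    set b := (ParamForm.linear (fun _ => 1) (fun _ => -1)).coeff with hb
    set a := (ParamForm.linear (fun _ => 1) (fun ν : ℤ => q ^ ν - 1)).coeff with ha
    have e1 : ∑ l ∈ Finset.range (d + 1), gCoeff q d l *
        qMulCoeff q (d + 1 - l) (B l) (A (d + 1 - l)) u μ =
        qMulCoeff q 1 (fun u (μ : ℤ) => if u = d then q ^ (μ * d) else 0) a u μ := by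
      rw [← ih, ← qMulCoeff_sum_left]
      refine Finset.sum_congr rfl fun l hl => ?_
      rw [Nat.sub_add_comm (by simpa [Nat.lt_succ_iff] using hl), hA, powCoeff_succ,
        ← qMulCoeff_assoc]
    have e2 : ∑ l ∈ Finset.range (d + 1), gCoeff q d l *
        qMulCoeff q (d - l) (B (l + 1)) (A (d - l)) u μ =
        qMulCoeff q d b (fun u (μ : ℤ) => if u = d then q ^ (μ * d) else 0) u μ := by
      rw [← ih, ← qMulCoeff_sum_right]
      refine Finset.sum_congr rfl fun l hl => ?_
      have hl : l ≤ d := by simpa [Nat.lt_succ_iff] using hl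
      rw [hB, ← qMulCoeff_sub_powCoeff, qMulCoeff_assoc, Nat.add_sub_cancel' hl]
    have e3 : ∑ l ∈ Finset.range (d + 2), gCoeff q (d + 1) l *
        qMulCoeff q (d + 1 - l) (B l) (A (d + 1 - l)) u μ =
        ∑ l ∈ Finset.range (d + 1), gCoeff q d l *
          qMulCoeff q (d + 1 - l) (B l) (A (d + 1 - l)) u μ - q ^ d *
        ∑ l ∈ Finset.range (d + 1), gCoeff q d l *
          qMulCoeff q (d - l) (B (l + 1)) (A (d - l)) u μ := by
      have h := Finset.sum_range_succ (fun l => gCoeff q d l *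
          qMulCoeff q (d + 1 - l) (B l) (A (d + 1 - l)) u μ) (d + 1)
      rw [gCoeff_eq_zero q (Nat.lt_succ_self d), zero_mul, add_zero] at h
      rw [← h, Finset.sum_range_succ', Finset.sum_range_succ' _ (d + 1), Finset.mul_sum]
      simp only [gCoeff_succ_succ, gCoeff_zero_right, Nat.add_sub_add_right, sub_mul,
        Finset.sum_sub_distrib, mul_assoc]
      ring
    have hexp : (μ - 1) * (d : ℤ) + d = μ * d := by ring
    rw [e3, e1, e2]
    cases u with
    | zero =>
      rw [qMulCoeff_linear_right_zero, qMulCoeff_linear_left_zero]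
      cases d <;> simp
    | succ u =>
      rw [qMulCoeff_linear_right, qMulCoeff_linear_left]
      -- Only the coefficients of `y^(d+1)` and `y^d` can be nonzero. The first is `q^(μ(d+1))`; the
      -- two contributions to the second cancel.
      by_cases h1 : u = d
      · subst h1
        simp only [Nat.succ_ne_self, if_false, if_true, mul_one]
        have f1 : q ^ u * q ^ ((μ - 1) * (u : ℤ)) = q ^ (μ * u) := by
          rw [← zpow_natCast q u, ← zpow_add₀ hq, add_comm, hexp]
        have f2 : q ^ u * q ^ (μ - (u : ℤ)) = q ^ μ := by
          rw [← zpow_natCast q u, ← zpow_add₀ hq]; congr 1; ring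
        have f3 : q ^ (μ * ((u + 1 : ℕ) : ℤ)) = q ^ (μ * (u : ℤ)) * q ^ μ := by
          rw [← zpow_add₀ hq]; congr 1; push_cast; ring
        rw [f3, ← f2]
        linear_combination (q ^ u) * f1
      · by_cases h2 : u + 1 = d
        · subst h2
          simp
        · simp [h1, h2]

end QProduct

/-! ### Linearity of the q-transform and its effect on the basis `y^(n-d) g_d`. -/

section QTransform

open MvPolynomial

variable (q : ℝ) (n : ℕ) (μ : ℤ)

theorem qMacWilliams_sum {ι : Type*} (K : Finset ι) (f : ι → MvPolynomial (Fin 2) ℝ) :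
    qMacWilliams q n (∑ k ∈ K, f k) μ = ∑ k ∈ K, qMacWilliams q n (f k) μ := by
  simp only [qMacWilliams, qTransform, coeff_sum, map_sum, Finset.sum_mul]
  exact Finset.sum_comm

theorem qMacWilliams_C_mul (c : ℝ) (f : MvPolynomial (Fin 2) ℝ) :
    qMacWilliams q n (C c * f) μ = C c * qMacWilliams q n f μ := by
  simp only [qMacWilliams, qTransform, coeff_C_mul, C_mul, Finset.mul_sum, mul_assoc]

theorem qMacWilliams_X_pow {i : ℕ} (hi : i ≤ n) :
    qMacWilliams q n (X 0 ^ (n - i) * X 1 ^ i) μ =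
      ∑ u ∈ Finset.range (n + 1),
        C (qMulCoeff q (n - i) (powCoeff q (fun _ => 1) (fun _ => -1) i)
          (powCoeff q (fun _ => 1) (fun ν => q ^ ν - 1) (n - i)) u μ) *
          X 0 ^ (n - u) * X 1 ^ u := by
  have hmon : (X 0 ^ (n - i) * X 1 ^ i : MvPolynomial (Fin 2) ℝ) =
      monomial (Finsupp.single 0 (n - i) + Finsupp.single 1 i) 1 := by
    rw [X_pow_eq_monomial, X_pow_eq_monomial, monomial_mul, one_mul]
  rw [qMacWilliams, qTransform, Finset.sum_eq_single i]
  · rw [hmon, coeff_monomial, if_pos rfl, C_1, one_mul, ParamForm.toPoly]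
    have hdeg : (ParamForm.qMul q
        (ParamForm.qPow q (ParamForm.linear (fun _ => 1) (fun _ => -1)) i)
        (ParamForm.qPow q (ParamForm.linear (fun _ => 1) (fun ν => q ^ ν - 1)) (n - i))).deg = n := by
      change _ + _ = n
      rw [deg_qPow_linear, deg_qPow_linear, Nat.add_sub_cancel' hi]
    rw [hdeg]
    simp only [ParamForm.qMul, deg_qPow_linear]
    rfl
  · intro j _ hj
    rw [hmon, coeff_monomial, if_neg, C_0, zero_mul]
    intro h
    have := DFunLike.congr_fun h 1
    simp at this
    exact hj this.symm
  · intro h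
    exact absurd (Finset.mem_range.2 (Nat.lt_succ_of_le hi)) h

theorem gProd_eq_sum_C (d : ℕ) :
    gProd (C q) d (X 0 : MvPolynomial (Fin 2) ℝ) (X 1) =
      ∑ l ∈ Finset.range (d + 1), C (gCoeff q d l) * X 0 ^ (d - l) * X 1 ^ l := by
  rw [← sum_gCoeff]
  simp only [map_gCoeff]

/-- With `N = n - d`, the factor `y^N` turns each `(x-y)^⟨l⟩` into `(x-y)^⟨N+l⟩`. By associativity
the transform is then `(x-y)^⟨N⟩` q-multiplied by `q^(μ d) y^d`. -/
theorem qMacWilliams_gProd {q : ℝ} (hq : q ≠ 0) {d : ℕ} (hd : d ≤ n) :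
    qMacWilliams q n (X 1 ^ (n - d) * gProd (C q) d (X 0) (X 1)) μ =
      C (q ^ (μ * d)) * (X 1 ^ d * gProd (C q) (n - d) (X 0) (X 1)) := by
  obtain ⟨N, rfl⟩ := Nat.exists_eq_add_of_le' hd
  rw [Nat.add_sub_cancel]
  have h1 : (X 1 ^ N * gProd (C q) d (X 0) (X 1) : MvPolynomial (Fin 2) ℝ) =
      ∑ l ∈ Finset.range (d + 1), C (gCoeff q d l) *
        (X 0 ^ (N + d - (N + l)) * X 1 ^ (N + l)) := by
    rw [gProd_eq_sum_C, Finset.mul_sum]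
    refine Finset.sum_congr rfl fun l _ => ?_
    rw [Nat.add_sub_add_left]
    ring
  have hcoeff : ∀ u, ∑ l ∈ Finset.range (d + 1), gCoeff q d l *
      qMulCoeff q (N + d - (N + l)) (powCoeff q (fun _ => 1) (fun _ => -1) (N + l))
        (powCoeff q (fun _ => 1) (fun ν => q ^ ν - 1) (N + d - (N + l))) u μ =
      if d ≤ u then q ^ (μ * d) * gCoeff q N (u - d) else 0 := by
    intro u
    have h2 : ∑ l ∈ Finset.range (d + 1), gCoeff q d l *
      qMulCoeff q (N + d - (N + l)) (powCoeff q (fun _ => 1) (fun _ => -1) (N + l))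
        (powCoeff q (fun _ => 1) (fun ν => q ^ ν - 1) (N + d - (N + l))) u μ =
        qMulCoeff q d (powCoeff q (fun _ => 1) (fun _ => -1) N)
          (fun u (μ : ℤ) => if u = d then q ^ (μ * d) else 0) u μ := by
      rw [← sum_gCoeff_qMulCoeff hq d, ← qMulCoeff_sum_right]
      refine Finset.sum_congr rfl fun l hl => ?_
      have hl : l ≤ d := by simpa [Nat.lt_succ_iff] using hl
      rw [Nat.add_sub_add_left, ← qMulCoeff_powCoeff, qMulCoeff_assoc, Nat.add_sub_cancel' hl]
    rw [h2, qMulCoeff, powCoeff_sub]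
    by_cases hu : d ≤ u
    · rw [if_pos hu, Finset.sum_eq_single (u - d)]
      -- The weight `q^((u-d) d)` of the q-product cancels the shift of `μ` by `u - d` in `q^(μ d)`.
      · rw [if_pos (by omega), ← zpow_natCast, mul_right_comm, ← zpow_add₀ hq]
        congr 2
        push_cast [hu]
        ring
      · intro i hi hne
        have := Finset.mem_range.1 hi
        rw [if_neg (by omega), mul_zero]
      · intro h
        exact absurd (Finset.mem_range.2 (by omega)) h
    · rw [if_neg hu]
      exact Finset.sum_eq_zero fun i _ => by rw [if_neg (by omega), mul_zero]
  rw [h1, qMacWilliams_sum]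
  have h3 : ∀ l ∈ Finset.range (d + 1), qMacWilliams q (N + d)
      (C (gCoeff q d l) * (X 0 ^ (N + d - (N + l)) * X 1 ^ (N + l))) μ =
      ∑ u ∈ Finset.range (N + d + 1), C (gCoeff q d l *
        qMulCoeff q (N + d - (N + l)) (powCoeff q (fun _ => 1) (fun _ => -1) (N + l))
        (powCoeff q (fun _ => 1) (fun ν => q ^ ν - 1) (N + d - (N + l))) u μ) *
          X 0 ^ (N + d - u) * X 1 ^ u := by
    intro l hl
    have hl : l ≤ d := by simpa [Nat.lt_succ_iff] using hl
    rw [qMacWilliams_C_mul, qMacWilliams_X_pow _ _ _ (by omega), Finset.mul_sum]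
    exact Finset.sum_congr rfl fun u _ => by rw [C_mul]; ring
  rw [Finset.sum_congr rfl h3, Finset.sum_comm]
  simp only [← Finset.sum_mul, ← map_sum, hcoeff]
  rw [add_right_comm, add_comm (N + 1) d, Finset.sum_range_add, Finset.sum_eq_zero, zero_add,
    gProd_eq_sum_C, Finset.mul_sum, Finset.mul_sum]
  · refine Finset.sum_congr rfl fun i _ => ?_
    rw [if_pos (Nat.le_add_right d i), Nat.add_sub_cancel_left, C_mul,
      show N + d - (d + i) = N - i by omega]
    ring
  · intro u hu
    rw [if_neg (by simpa using hu), C_0, zero_mul, zero_mul]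

end QTransform

/-! ## The MacWilliams identity for polymatroids -/

section Polymatroid

open MvPolynomial

variable {F : Type*} [Field F] {n m : ℕ}

theorem mem_subspaces {V : Type*} [AddCommGroup V] [Module F V] [Finite V] (U : Submodule F V) :
    U ∈ subspaces F V := by simp [subspaces]

theorem QMPolymatroid.rank_bot (P : QMPolymatroid F n m) : P.rank ⊥ = 0 := by
  have := P.rank_le ⊥
  simpa using this

theorem orth_top : orth (⊤ : Submodule F (Fin n → F)) = ⊥ := by
  have := finrank_orth (⊤ : Submodule F (Fin n → F))
  rw [finrank_top, finrank_fin_fun] at this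
  exact Submodule.finrank_eq_zero.1 (by omega)

/-- Ensures that the natural-number subtraction in `QMPolymatroid.dual` never truncates. -/
theorem QMPolymatroid.rank_top_le (P : QMPolymatroid F n m) (J : Submodule F (Fin n → F)) :
    P.rank ⊤ ≤ P.rank (orth J) + m * finrank F J := by
  have h1 := P.rank_le_add (le_top : orth J ≤ ⊤)
  have hJ := congrArg (m * ·) (finrank_orth J)
  rw [finrank_top, finrank_fin_fun] at h1
  simp only [mul_add] at hJ
  omega

theorem QMPolymatroid.dual_rank_sub (P : QMPolymatroid F n m) (J : Submodule F (Fin n → F)) :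
    (P.dual.rank ⊤ : ℤ) - P.dual.rank (orth J) = (m : ℤ) * finrank F J - P.rank J := by
  have h1 := P.rank_top_le ⊤
  have h2 := P.rank_top_le (orth J)
  have h3 := congrArg (m * ·) (finrank_orth J)
  change (((P.rank (orth ⊤) + m * finrank F (⊤ : Submodule F (Fin n → F)) - P.rank ⊤ : ℕ) : ℤ) -
    ((P.rank (orth (orth J)) + m * finrank F (orth J) - P.rank ⊤ : ℕ) : ℤ)) = _
  rw [Nat.cast_sub h1, Nat.cast_sub h2, orth_orth, orth_top, P.rank_bot, finrank_top,
    finrank_fin_fun]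
  simp only [mul_add] at h3
  push_cast
  zify at h3
  linarith

variable [Fintype F]

theorem one_lt_card_real (F : Type*) [Field F] [Fintype F] : (1 : ℝ) < Fintype.card F := by
  exact_mod_cast Fintype.one_lt_card

theorem sum_subspaces_orth {M : Type*} [AddCommMonoid M] (f : Submodule F (Fin n → F) → M) :
    ∑ U ∈ subspaces F (Fin n → F), f U = ∑ U ∈ subspaces F (Fin n → F), f (orth U) :=
  Finset.sum_nbij' orth orth (fun _ _ => mem_subspaces _) (fun _ _ => mem_subspaces _)
    (fun U _ => orth_orth U) (fun U _ => orth_orth U) (fun U _ => by rw [orth_orth])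

theorem qMacWilliams_higherWeight (P : QMPolymatroid F n m) (l : ℕ) (μ : ℤ) :
    qMacWilliams (Fintype.card F) n (P.higherWeight l) μ =
      ∑ U ∈ subspaces F (Fin n → F),
        C (qBinom (Fintype.card F) ((P.rank ⊤ : ℤ) - P.rank U) l *
          (Fintype.card F : ℝ) ^ (μ * finrank F U)) *
          (X 1 ^ finrank F U * gProd (C (Fintype.card F : ℝ)) (n - finrank F U) (X 0) (X 1)) := by
  have hq : (Fintype.card F : ℝ) ≠ 0 := (zero_lt_one.trans (one_lt_card_real F)).ne'
  rw [QMPolymatroid.higherWeight, qMacWilliams_sum]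
  refine Finset.sum_congr rfl fun U _ => ?_
  have hU : finrank F U ≤ n := by have := finrank_orth U; omega
  rw [mul_assoc, qMacWilliams_C_mul, C_mul, mul_assoc, ← qMacWilliams_gProd n μ hq hU,
    map_natCast]

theorem QMPolymatroid.higherWeight_dual (P : QMPolymatroid F n m) (r : ℕ) :
    P.dual.higherWeight r =
      ∑ j ∈ Finset.range (r + 1), ∑ l ∈ Finset.range (j + 1),
        C (macWilliamsCoeff (Fintype.card F) r j l (P.rank ⊤)) *
          qMacWilliams (Fintype.card F) n (P.higherWeight l) ((m : ℤ) * j) := by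
  simp only [qMacWilliams_higherWeight, Finset.mul_sum]
  rw [QMPolymatroid.higherWeight, sum_subspaces_orth]
  -- With the sum over `U` outermost on both sides, the summands can be compared for each `U`
  -- separately.
  simp only [Finset.sum_comm (t := subspaces F (Fin n → F))]
  refine Finset.sum_congr rfl fun U _ => ?_
  have hU := finrank_orth U
  rw [P.dual_rank_sub, qBinom_sub_eq_sum (one_lt_card_real F) _ _ (P.rank ⊤)]
  rw [show n - finrank F (orth U) = finrank F U by omega,
    show finrank F (orth U) = n - finrank F U by omega, map_sum, Finset.sum_mul, Finset.sum_mul]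
  refine Finset.sum_congr rfl fun j _ => ?_
  rw [map_sum, Finset.sum_mul, Finset.sum_mul]
  refine Finset.sum_congr rfl fun l _ => ?_
  rw [C_mul, map_natCast, show (m : ℤ) * finrank F U * j = (m : ℤ) * j * finrank F U by ring]
  ring

end Polymatroid

/-! ## Counting subspaces -/

section Count

variable {F V : Type*} [Field F] [AddCommGroup V] [Module F V] [Finite V]

/-- The linearly independent families spanning `D` are the linearly independent families of `D`. -/
def linearIndependentFiberEquiv {r : ℕ} (D : Submodule F V) (hD : finrank F D = r) :
    {x : {s : Fin r → V // LinearIndependent F s} // Submodule.span F (Set.range x.1) = D} ≃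
      {t : Fin r → D // LinearIndependent F t} where
  toFun x := ⟨fun i => ⟨x.1.1 i, x.2.le (Submodule.subset_span (Set.mem_range_self i))⟩,
    LinearIndependent.of_comp D.subtype x.1.2⟩
  invFun t := ⟨⟨D.subtype ∘ t.1, t.2.map' D.subtype D.ker_subtype⟩, by
    refine Submodule.eq_of_le_of_finrank_eq ?_ ?_
    · rw [Submodule.span_le]
      rintro _ ⟨i, rfl⟩
      exact (t.1 i).2
    · rw [hD]
      exact (finrank_span_eq_card (t.2.map' D.subtype D.ker_subtype)).trans (Fintype.card_fin r)⟩
  left_inv _ := rfl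
  right_inv _ := rfl

variable [Fintype F]

theorem natCard_linearIndependent_real (r : ℕ) :
    (Nat.card {s : Fin r → V // LinearIndependent F s} : ℝ) =
      gProd (Fintype.card F : ℝ) r ((Fintype.card F : ℝ) ^ finrank F V) 1 := by
  rcases le_or_gt r (finrank F V) with h | h
  · rw [card_linearIndependent h, gProd, ← Fin.prod_univ_eq_prod_range (fun i : ℕ =>
      (Fintype.card F : ℝ) ^ finrank F V - (Fintype.card F : ℝ) ^ i * 1), Nat.cast_prod]
    refine Finset.prod_congr rfl fun i _ => ?_
    rw [Nat.cast_sub (Nat.pow_le_pow_right Fintype.card_pos (i.2.le.trans h))]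
    push_cast
    ring
  -- When `r` exceeds the dimension, the product contains the zero factor with index `finrank F V`.
  · have : IsEmpty {s : Fin r → V // LinearIndependent F s} :=
      ⟨fun s => by
        have := s.2.fintype_card_le_finrank
        rw [Fintype.card_fin] at this
        omega⟩
    rw [Nat.card_of_isEmpty, Nat.cast_zero, gProd, eq_comm]
    exact Finset.prod_eq_zero (Finset.mem_range.2 h) (by ring)

/-- Count the linearly independent `r`-families of `V` by their span: every fibre has `g_r(q^r, 1)`
elements and the total is `g_r(q^(dim V), 1)`. -/
theorem natCard_submodule_finrank (r : ℕ) :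
    (Nat.card {D : Submodule F V // finrank F D = r} : ℝ) =
      gaussBinom (Fintype.card F : ℝ) (finrank F V) r := by
  let f : {s : Fin r → V // LinearIndependent F s} → {D : Submodule F V // finrank F D = r} :=
    fun s => ⟨Submodule.span F (Set.range s.1), by
      rw [finrank_span_eq_card s.2, Fintype.card_fin]⟩
  have h1 : Nat.card {s : Fin r → V // LinearIndependent F s} =
      ∑ᶠ D : {D : Submodule F V // finrank F D = r}, Nat.card {x // f x = D} := by
    have := Fintype.ofFinite {D : Submodule F V // finrank F D = r}
    rw [finsum_eq_sum_of_fintype, ← Nat.card_sigma]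
    exact Nat.card_congr (Equiv.sigmaFiberEquiv f).symm
  have h2 : ∀ D : {D : Submodule F V // finrank F D = r},
      (Nat.card {x // f x = D} : ℝ) =
        gProd (Fintype.card F : ℝ) r ((Fintype.card F : ℝ) ^ r) 1 := by
    intro D
    have e : {x // f x = D} ≃ {t : Fin r → D.1 // LinearIndependent F t} :=
      (Equiv.subtypeEquivRight fun x => Subtype.ext_iff).trans
        (linearIndependentFiberEquiv D.1 D.2)
    rw [Nat.card_congr e, natCard_linearIndependent_real, D.2]
  have h3 : (Nat.card {s : Fin r → V // LinearIndependent F s} : ℝ) =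
      Nat.card {D : Submodule F V // finrank F D = r} *
        gProd (Fintype.card F : ℝ) r ((Fintype.card F : ℝ) ^ r) 1 := by
    have := Fintype.ofFinite {D : Submodule F V // finrank F D = r}
    rw [h1, finsum_eq_sum_of_fintype, Nat.cast_sum, Finset.sum_congr rfl fun D _ => h2 D,
      Finset.sum_const, nsmul_eq_mul, Finset.card_univ, Nat.card_eq_fintype_card]
  rw [natCard_linearIndependent_real, ← gaussBinom_mul_gProd] at h3
  exact (mul_right_cancel₀ (gProd_self_ne_zero (one_lt_card_real F) r) h3).symm

open Classical in
theorem card_subspaces_le_finrank (W : Submodule F V) (r : ℕ) :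
    (((subspaces F V).filter (fun D => D ≤ W ∧ finrank F D = r)).card : ℝ) =
      gaussBinom (Fintype.card F : ℝ) (finrank F W) r := by
  rw [← natCard_submodule_finrank, Nat.cast_inj,
    ← Nat.subtype_card (p := fun D => D ≤ W ∧ finrank F D = r) _ (by simp [mem_subspaces])]
  refine Nat.card_congr
    { toFun := fun D => ⟨D.1.comap W.subtype, ?_⟩
      invFun := fun D => ⟨D.1.map W.subtype, Submodule.map_subtype_le W D.1, ?_⟩
      left_inv := fun D => Subtype.ext ?_
      right_inv := fun D => Subtype.ext ?_ }
  · exact (LinearEquiv.finrank_eq (Submodule.comapSubtypeEquivOfLe D.2.1)).trans D.2.2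
  · rw [Submodule.finrank_map_subtype_eq, D.2]
  · exact (Submodule.map_comap_subtype _ _).trans (inf_eq_right.2 D.2.1)
  · exact Submodule.comap_map_eq_of_injective W.injective_subtype D.1

open Classical MvPolynomial in
theorem sum_subspaces_le (W : Submodule F V) (h : ℕ → MvPolynomial (Fin 2) ℝ) :
    ∑ U ∈ (subspaces F V).filter (· ≤ W), h (finrank F U) =
      ∑ u ∈ Finset.range (finrank F W + 1),
        C (gaussBinom (Fintype.card F : ℝ) (finrank F W) u) * h u := by
  rw [← Finset.sum_fiberwise_of_maps_to (t := Finset.range (finrank F W + 1))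
    (g := fun U : Submodule F V => finrank F U) fun U hU => Finset.mem_range.2 (Nat.lt_succ_of_le
      (Submodule.finrank_mono (Finset.mem_filter.1 hU).2))]
  refine Finset.sum_congr rfl fun u _ => ?_
  rw [← card_subspaces_le_finrank, Finset.filter_filter, map_natCast, ← nsmul_eq_mul,
    ← Finset.sum_const]
  exact Finset.sum_congr rfl fun U hU => by rw [(Finset.mem_filter.1 hU).2.2]

end Count

/-! ## Rank-metric codes -/

section Codes

variable {F : Type*} [Field F] {n m : ℕ}

theorem codeSupp_le_iff (D : Submodule F (Matrix (Fin n) (Fin m) F))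
    (J : Submodule F (Fin n → F)) : codeSupp D ≤ J ↔ ∀ M ∈ D, matSupp M ≤ J := by
  simp [codeSupp]

theorem le_codeShorten_iff (C D : Submodule F (Matrix (Fin n) (Fin m) F))
    (J : Submodule F (Fin n → F)) : D ≤ codeShorten C J ↔ D ≤ C ∧ codeSupp D ≤ J := by
  rw [codeSupp_le_iff]
  exact ⟨fun h => ⟨fun M hM => (h hM).1, fun M hM => (h hM).2⟩,
    fun h M hM => ⟨h.1 hM, h.2 M hM⟩⟩

theorem le_orth_comm {A B : Submodule F (Fin n → F)} : A ≤ orth B ↔ B ≤ orth A :=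
  ⟨fun h => by simpa only [orth_orth] using orth_anti h,
    fun h => by simpa only [orth_orth] using orth_anti h⟩

theorem codeShorten_bot (C : Submodule F (Matrix (Fin n) (Fin m) F)) : codeShorten C ⊥ = ⊥ := by
  rw [eq_bot_iff]
  rintro M ⟨-, hM⟩
  rw [matSupp_le_iff] at hM
  ext i j
  exact congrFun ((Submodule.mem_bot F).1 (hM j)) i

theorem codePolymatroid_rank_top (C : Submodule F (Matrix (Fin n) (Fin m) F)) :
    (codePolymatroid C).rank ⊤ = finrank F C := by
  change finrank F C - finrank F (codeShorten C (orth ⊤)) = _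
  rw [orth_top, codeShorten_bot, finrank_bot, Nat.sub_zero]

theorem finrank_codeShorten_le (C : Submodule F (Matrix (Fin n) (Fin m) F))
    (J : Submodule F (Fin n → F)) : finrank F (codeShorten C J) ≤ finrank F C :=
  Submodule.finrank_mono fun _ hM => hM.1

/-! ### Duality -/

theorem trace_mul_transpose_eq (M N : Matrix (Fin n) (Fin m) F) :
    (M * N.transpose).trace = ∑ j, M.col j ⬝ᵥ N.col j := by
  simp only [Matrix.trace, Matrix.diag, Matrix.mul_apply, Matrix.transpose_apply, dotProduct,
    Matrix.col_apply]
  exact Finset.sum_comm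

/-- The bilinear form `Tr (M Nᵀ)` on matrices. -/
def matTraceForm (F : Type*) [Field F] (n m : ℕ) :
    LinearMap.BilinForm F (Matrix (Fin n) (Fin m) F) :=
  LinearMap.mk₂ F (fun M N => (M * N.transpose).trace)
    (fun _ _ _ => by rw [Matrix.add_mul, Matrix.trace_add])
    (fun _ _ _ => by rw [Matrix.smul_mul, Matrix.trace_smul])
    (fun _ _ _ => by rw [Matrix.transpose_add, Matrix.mul_add, Matrix.trace_add])
    (fun _ _ _ => by rw [Matrix.transpose_smul, Matrix.mul_smul, Matrix.trace_smul])

theorem matTraceForm_apply (M N : Matrix (Fin n) (Fin m) F) :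
    matTraceForm F n m M N = (M * N.transpose).trace := rfl

theorem matTraceForm_comm (M N : Matrix (Fin n) (Fin m) F) :
    matTraceForm F n m M N = matTraceForm F n m N M := by
  rw [matTraceForm_apply, matTraceForm_apply, ← Matrix.trace_transpose, Matrix.transpose_mul,
    Matrix.transpose_transpose]

theorem matTraceForm_nondegenerate : (matTraceForm F n m).Nondegenerate := by
  have h : ∀ N, (∀ M, matTraceForm F n m M N = 0) → N = 0 := fun N hN => by
    ext i j
    have := hN (Matrix.single i j 1)
    rwa [matTraceForm_apply, Matrix.trace_single_mul, one_smul] at this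
  exact ⟨fun N hN => h N fun M => by rw [matTraceForm_comm, hN], h⟩

theorem codeDual_eq (C : Submodule F (Matrix (Fin n) (Fin m) F)) :
    codeDual C = (matTraceForm F n m).orthogonal C := by
  ext N
  rw [LinearMap.BilinForm.mem_orthogonal_iff]
  rfl

theorem finrank_codeDual (C : Submodule F (Matrix (Fin n) (Fin m) F)) :
    finrank F C + finrank F (codeDual C) = n * m := by
  have h := LinearMap.BilinForm.finrank_orthogonal (matTraceForm_nondegenerate (F := F)) C
  have h' := Submodule.finrank_le C
  rw [← codeDual_eq] at h
  rw [finrank_matrix, Fintype.card_fin, Fintype.card_fin, finrank_self, mul_one] at h h'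
  omega

theorem codeDual_sup (A B : Submodule F (Matrix (Fin n) (Fin m) F)) :
    codeDual (A ⊔ B) = codeDual A ⊓ codeDual B := by
  ext N
  constructor
  · exact fun h => ⟨fun M hM => h M (le_sup_left (b := B) hM),
      fun M hM => h M (le_sup_right (a := A) hM)⟩
  · rintro ⟨hA, hB⟩ M hM
    obtain ⟨a, ha, b, hb, rfl⟩ := Submodule.mem_sup.mp hM
    rw [Matrix.add_mul, Matrix.trace_add, hA a ha, hB b hb, add_zero]

/-- Matrices with column space in `J`, as families of columns. -/
def shortenTopEquiv (J : Submodule F (Fin n → F)) :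
    codeShorten (⊤ : Submodule F (Matrix (Fin n) (Fin m) F)) J ≃ₗ[F] (Fin m → J) where
  toFun M j := ⟨M.1.col j, (matSupp_le_iff _ _).1 M.2.2 j⟩
  map_add' _ _ := rfl
  map_smul' _ _ := rfl
  invFun f := ⟨Matrix.of fun i j => (f j).1 i, trivial, (matSupp_le_iff _ _).2 fun j => (f j).2⟩
  left_inv _ := rfl
  right_inv _ := rfl

theorem finrank_codeShorten_top (J : Submodule F (Fin n → F)) :
    finrank F (codeShorten (⊤ : Submodule F (Matrix (Fin n) (Fin m) F)) J) = m * finrank F J := by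
  rw [(shortenTopEquiv J).finrank_eq, finrank_pi_fintype, Finset.sum_const, Finset.card_univ,
    Fintype.card_fin, smul_eq_mul]

/-- The trace form is the sum of the column inner products, which gives one inclusion; equality
follows from dimensions. -/
theorem codeDual_codeShorten_top (J : Submodule F (Fin n → F)) :
    codeDual (codeShorten (⊤ : Submodule F (Matrix (Fin n) (Fin m) F)) J) =
      codeShorten ⊤ (orth J) := by
  refine (Submodule.eq_of_le_of_finrank_eq ?_ ?_).symm
  · rintro N ⟨-, hN⟩ M ⟨-, hM⟩
    rw [matSupp_le_iff] at hN hM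
    rw [trace_mul_transpose_eq]
    exact Finset.sum_eq_zero fun j _ => hN j _ (hM j)
  · have h1 := finrank_codeDual (codeShorten (⊤ : Submodule F (Matrix (Fin n) (Fin m) F)) J)
    have h2 := congrArg (m * ·) (finrank_orth J)
    simp only [mul_add] at h2
    rw [finrank_codeShorten_top] at h1 ⊢
    rw [mul_comm n m] at h1
    omega

theorem codeShorten_eq_inf (C : Submodule F (Matrix (Fin n) (Fin m) F))
    (J : Submodule F (Fin n → F)) : codeShorten C J = C ⊓ codeShorten ⊤ J := by
  ext M
  exact ⟨fun h => ⟨h.1, trivial, h.2⟩, fun h => ⟨h.1, h.2.2⟩⟩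

/-- With `M(J)` the space of all matrices supported in `J`, the left-hand code is the dual of `C +
M(J)`; compute its dimension using `C ∩ M(J) = C(J)`. -/
theorem finrank_codeShorten_codeDual (C : Submodule F (Matrix (Fin n) (Fin m) F))
    (J : Submodule F (Fin n → F)) :
    finrank F (codeShorten (codeDual C) (orth J)) + m * finrank F J =
      finrank F (codeShorten C J) + finrank F (codeDual C) := by
  have h1 := finrank_codeDual (C ⊔ codeShorten ⊤ J)
  have h2 := finrank_codeDual C
  have h3 := Submodule.finrank_sup_add_finrank_inf_eq C (codeShorten ⊤ J)
  rw [codeDual_sup, codeDual_codeShorten_top, ← codeShorten_eq_inf] at h1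
  rw [← codeShorten_eq_inf, finrank_codeShorten_top] at h3
  omega

theorem dual_codePolymatroid (C : Submodule F (Matrix (Fin n) (Fin m) F)) :
    (codePolymatroid C).dual = codePolymatroid (codeDual C) := by
  ext J
  change (codePolymatroid C).rank (orth J) + m * finrank F J - (codePolymatroid C).rank ⊤ =
    finrank F (codeDual C) - finrank F (codeShorten (codeDual C) (orth J))
  rw [codePolymatroid_rank_top]
  change finrank F C - finrank F (codeShorten C (orth (orth J))) + m * finrank F J - finrank F C = _
  rw [orth_orth]
  have h1 := finrank_codeShorten_codeDual C J
  have h2 := finrank_codeShorten_le C J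
  have h3 := finrank_codeShorten_le (codeDual C) (orth J)
  omega

/-! ### Higher weights -/

variable [Fintype F]

open MvPolynomial

theorem higherRankWeightEnum_eq_zero (C : Submodule F (Matrix (Fin n) (Fin m) F)) {l : ℕ}
    (hl : finrank F C < l) : higherRankWeightEnum C l = 0 := by
  classical
  rw [higherRankWeightEnum, Finset.filter_false_of_mem, Finset.sum_empty]
  rintro D - ⟨h1, h2⟩
  have := Submodule.finrank_mono h1
  omega

open Classical in
-- Grouping the `U` by dimension turns the sum into `sum_gaussBinom_gProd` for `j = dim W`, times
-- `y^(n - dim W)`.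
theorem sum_gProd_le (W : Submodule F (Fin n → F)) :
    ∑ U ∈ (subspaces F (Fin n → F)).filter (· ≤ W),
      (X 1 ^ (n - finrank F U) * gProd (Fintype.card F : MvPolynomial (Fin 2) ℝ) (finrank F U)
        (X 0) (X 1)) = X 0 ^ finrank F W * X 1 ^ (n - finrank F W) := by
  have hW : finrank F W ≤ n := by have := finrank_orth W; omega
  rw [sum_subspaces_le W fun d => X 1 ^ (n - d) *
    gProd (Fintype.card F : MvPolynomial (Fin 2) ℝ) d (X 0) (X 1),
    ← sum_gaussBinom_gProd (Fintype.card F : MvPolynomial (Fin 2) ℝ) (X 0) (X 1), Finset.sum_mul]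
  refine Finset.sum_congr rfl fun u hu => ?_
  have hu : u ≤ finrank F W := by simpa [Nat.lt_succ_iff] using hu
  rw [map_gaussBinom, map_natCast, show n - u = (finrank F W - u) + (n - finrank F W) by omega,
    pow_add]
  ring

theorem codePolymatroid_higherWeight (C : Submodule F (Matrix (Fin n) (Fin m) F)) (r : ℕ) :
    (codePolymatroid C).higherWeight r = higherRankWeightEnum C r := by
  classical
  rw [QMPolymatroid.higherWeight, higherRankWeightEnum]
  -- The upper entry is `dim C(U^⊥)`, so the coefficient counts the `r`-dimensional `D ≤ C` with
  -- support in `U^⊥`, equivalently with `U` in the orthogonal complement of the support.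
  have h1 : ∀ U : Submodule F (Fin n → F),
      (MvPolynomial.C (qBinom (Fintype.card F)
        (((codePolymatroid C).rank ⊤ : ℤ) - (codePolymatroid C).rank U) r) :
          MvPolynomial (Fin 2) ℝ) =
      ∑ D ∈ (subspaces F (Matrix (Fin n) (Fin m) F)).filter (fun D => D ≤ C ∧ finrank F D = r),
        if U ≤ orth (codeSupp D) then 1 else 0 := by
    intro U
    have hU : ((codePolymatroid C).rank ⊤ : ℤ) - (codePolymatroid C).rank U =
        (finrank F (codeShorten C (orth U)) : ℕ) := by
      rw [codePolymatroid_rank_top]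
      change (finrank F C : ℤ) - ((finrank F C - finrank F (codeShorten C (orth U)) : ℕ) : ℤ) = _
      rw [Nat.cast_sub (finrank_codeShorten_le C (orth U))]
      ring
    rw [hU, qBinom_natCast (one_lt_card_real F), ← card_subspaces_le_finrank, map_natCast,
      Finset.sum_boole, Finset.filter_filter]
    congr 2
    refine Finset.filter_congr fun D _ => ?_
    rw [le_codeShorten_iff, le_orth_comm]
    tauto
  simp only [h1, Finset.sum_mul]
  rw [Finset.sum_comm]
  refine Finset.sum_congr rfl fun D _ => ?_
  have hD := finrank_orth (codeSupp D)
  simp only [ite_mul, one_mul, zero_mul]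
  rw [← Finset.sum_filter, sum_gProd_le, codeWt,
    show finrank F (orth (codeSupp D)) = n - finrank F (codeSupp D) by omega,
    Nat.sub_sub_self (by omega)]

end Codes

theorem mainTheorem7 {F : Type*} [Field F] [Fintype F] (n m : ℕ) :
    (∀ (P : QMPolymatroid F n m) (r : ℕ),
      P.dual.higherWeight r =
        ∑ j ∈ Finset.range (r + 1), ∑ l ∈ Finset.range (j + 1),
          MvPolynomial.C (macWilliamsCoeff (Fintype.card F) r j l (P.rank ⊤)) *
            qMacWilliams (Fintype.card F) n (P.higherWeight l) ((m : ℤ) * j)) ∧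
    (∀ C : Submodule F (Matrix (Fin n) (Fin m) F),
      (∀ r : ℕ, (codePolymatroid C).higherWeight r = higherRankWeightEnum C r) ∧
      (∀ r : ℕ, (codePolymatroid C).dual.higherWeight r = higherRankWeightEnum (codeDual C) r) ∧
      (∀ r : ℕ, r ≤ n * m - Module.finrank F C →
        higherRankWeightEnum (codeDual C) r =
          ∑ j ∈ Finset.range (r + 1), ∑ l ∈ Finset.range (min j (Module.finrank F C) + 1),
            MvPolynomial.C (macWilliamsCoeff (Fintype.card F) r j l (Module.finrank F C)) *
              qMacWilliams (Fintype.card F) n (higherRankWeightEnum C l) ((m : ℤ) * j))) := by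
  have hdual : ∀ (C : Submodule F (Matrix (Fin n) (Fin m) F)) (r : ℕ),
      (codePolymatroid C).dual.higherWeight r = higherRankWeightEnum (codeDual C) r :=
    fun C r => by rw [dual_codePolymatroid, codePolymatroid_higherWeight]
  refine ⟨QMPolymatroid.higherWeight_dual, fun C =>
    ⟨codePolymatroid_higherWeight C, hdual C, fun r _ => ?_⟩⟩
  rw [← hdual, QMPolymatroid.higherWeight_dual]
  refine Finset.sum_congr rfl fun j _ => ?_
  simp only [codePolymatroid_rank_top, codePolymatroid_higherWeight]
  -- The terms with `dim C < l ≤ j` vanish, as `C` has no subcode of dimension `l`.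
  refine (Finset.sum_subset (Finset.range_subset_range.2 (by omega)) fun l hl hl' => ?_).symm
  rw [Finset.mem_range] at hl hl'
  rw [higherRankWeightEnum_eq_zero C (by omega)]
  simp [qMacWilliams, qTransform]
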